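/- Consider a highway, modelled as the real line, with the typical vehicular user (VU) at the origin. Fix $\lambda_r,P_t,\alpha,\sigma^2,B>0$ and $\tau\ge 0$. **Load.** Road-side units (RSUs) form a homogeneous Poisson point process (PPP) of density $\lambda_r$; every VU is served by its nearest RSU, so that each RSU serves its Voronoi cell. The tagged RSU is the one serving the typical VU, and $\widetilde S$ is the number of VUs, other than the typical one, in its cell. The VUs are independent of the RSUs and are distributed as follows. (i) Non-platooned traffic (N-PTS): the other VUs form a PPP of density $\lambda>0$. (ii) Platooned traffic (PTS): the VUs form a Matérn cluster process with parent density $\lambda_P>0$, in which every parent $x$ has a $\mathrm{Poisson}(m)$ number of daughters, independent and uniform on $[x-a,x+a]$ ($m,a>0$). Seen from the typical VU, the other VUs are the union of such a process and of one further independent cluster, with $\mathrm{Poisson}(m)$ points independent and uniform on $[x_0-a,x_0+a]$, whose centre $x_0$ is uniform on $[-a,a]$. **SINR.** Let $R$ be the distance from the origin to the nearest RSU, let $p$ be the probability that the typical RSU (an RSU placed at the origin in addition to the PPP, with the VUs forming the PPP of density $\lambda$, respectively the Matérn cluster process) serves at least one VU, and let the active RSUs be modelled as a PPP $\Phi_a$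 of density $p\lambda_r$, independent of $R$. Put $$\mathrm{SINR}=\frac{H P_t R^{-\alpha}}{I+\sigma^2},\qquad I=\sum_{z_i\in\Phi_a,\ |z_i|>R}H_iP_t|z_i|^{-\alpha},$$ with $H,H_i$ independent exponential variables of mean one, independent of $R$ and $\Phi_a$ ($\mathrm{SINR}=0$ if $I=\infty$). Let $p_c(\theta)=\mathbb P[\mathrm{SINR}>\theta]$ be the coverage probability. **Rate.** As usual in this model, the load and the SINR are taken to be independent: all the random elements that enter $\widetilde S$ (the RSUs that determine the cells, and the VUs) are independent of those that enter the SINR (the RSUs that determine $R$, the active RSUs, and the fading). The rate of the typical VU is $\mathcal R_c=\frac{B}{\widetilde S+1}\log_2(1+\mathrm{SINR})$, and its rate coverage is $r_c(\tau)=\mathbb P[\mathcal R_c>\tau]$. **Theorem.** Both in PTS and in N-PTS, with the load $\widetilde S$ and the active probability $p$ of the respective scenario, $$r_c(\tau)=\sum_{k=0}^{\infty}\mathbb P[\widetilde S=k]\;p_c\!\left(2^{\tau(k+1)/B}-1\right).$$ -/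

import Mathlib

open MeasureTheory ProbabilityTheory
open scoped ENNReal NNReal

noncomputable section

namespace Platoon

/-! ### Point patterns, Voronoi cells on the line -/

/-- Number of points of the pattern `(x i)` that lie in `A`. -/
def count (x : ℕ → ℝ) (A : Set ℝ) : ℕ∞ := {i | x i ∈ A}.encard

/-- Voronoi cell of a site at `c` with respect to the sites `z j`. -/
def voronoiCell (z : ℕ → ℝ) (c : ℝ) : Set ℝ := {x | ∀ j, |x - c| ≤ |x - z j|}

/-- The cell of the RSU that serves the typical VU (which is at the origin). -/
def taggedCell (z : ℕ → ℝ) : Set ℝ :=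
  {x | ∃ k, (0 : ℝ) ∈ voronoiCell z (z k) ∧ x ∈ voronoiCell z (z k)}

/-- The cell of the typical RSU: a site is placed at the origin, the others are the `z j`. -/
def typicalCell (z : ℕ → ℝ) : Set ℝ := voronoiCell z 0

section

variable {Ω : Type*} [MeasurableSpace Ω]

/-- The random points `(x i)` form a homogeneous Poisson point pattern on the line
of density `ν`. -/
structure IsPPP (P : Measure Ω) (x : ℕ → Ω → ℝ) (ν : ℝ) : Prop where
  measurable : ∀ i, Measurable (x i)
  poisson : ∀ A : Set ℝ, MeasurableSet A → volume A ≠ ∞ → ∀ k : ℕ,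
    P {ω | count (fun i => x i ω) A = (k : ℕ∞)} =
      poissonMeasure (Real.toNNReal (ν * volume.real A)) {k}
  indep : ∀ (n : ℕ) (A : Fin n → Set ℝ), (∀ j, MeasurableSet (A j)) →
    (∀ j, volume (A j) ≠ ∞) → Pairwise (fun j l => Disjoint (A j) (A l)) →
    iIndepFun (fun j ω => count (fun i => x i ω) (A j)) P

/-- The uniform distribution on `[-a, a]`. -/
def uniformBall (a : ℝ) : Measure ℝ := volume[|Set.Icc (-a) a]

/-- The σ-algebra generated by a random element. -/
abbrev gen {E : Type*} [MeasurableSpace E] (X : Ω → E) : MeasurableSpace Ω :=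
  MeasurableSpace.comap X inferInstance

/-! ### The radio link of the typical VU -/

/-- Randomness behind the SINR: the RSU locations (which determine the serving distance), the
locations of the active RSUs, the fading gain of the serving link, and those of the interfering
links. -/
structure Link (Ω : Type*) where
  rsu : ℕ → Ω → ℝ
  active : ℕ → Ω → ℝ
  gain : Ω → ℝ
  gains : ℕ → Ω → ℝ

namespace Link

/-- Distributions: RSUs of density `lr`, active RSUs of density `la`, and independent Rayleigh
fading (exponential power gains of mean one). Independence between the components is stated as
part of the whole system below. -/
structure IsModel (X : Link Ω) (P : Measure Ω) (lr la : ℝ) : Prop where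
  rsu_ppp : IsPPP P X.rsu lr
  active_ppp : IsPPP P X.active la
  gain_meas : Measurable X.gain
  gain_law : P.map X.gain = expMeasure 1
  gains_meas : ∀ i, Measurable (X.gains i)
  gains_law : ∀ i, P.map (X.gains i) = expMeasure 1
  gains_indep : iIndepFun X.gains P

/-- Distance from the typical VU at the origin to its nearest RSU. -/
def dist (X : Link Ω) (ω : Ω) : ℝ := ⨅ i, |X.rsu i ω|

/-- Interference from the active RSUs farther away than the serving distance. -/
def interference (X : Link Ω) (Pt α : ℝ) (ω : Ω) : ℝ≥0∞ :=
  open scoped Classical in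
  ∑' i, if X.dist ω < |X.active i ω|
    then ENNReal.ofReal (X.gains i ω * Pt * |X.active i ω| ^ (-α)) else 0

/-- The SINR at the typical VU, with noise power `noise`; it is `0` if the interference is
infinite. -/
def sinr (X : Link Ω) (Pt α noise : ℝ) (ω : Ω) : ℝ :=
  (ENNReal.ofReal (X.gain ω * Pt * X.dist ω ^ (-α)) /
    (X.interference Pt α ω + ENNReal.ofReal noise)).toReal

/-- Coverage probability at SINR threshold `θ`. -/
def coverage (X : Link Ω) (P : Measure Ω) (Pt α noise θ : ℝ) : ℝ :=
  P.real {ω | θ < X.sinr Pt α noise ω}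

/-- Rate of the typical VU when the tagged RSU, of bandwidth `B`, serves `S ω` further VUs;
it is `0` if `S ω` is infinite. -/
def rate (X : Link Ω) (S : Ω → ℕ∞) (B Pt α noise : ℝ) (ω : Ω) : ℝ :=
  (ENNReal.ofReal B / ((S ω : ℝ≥0∞) + 1)).toReal * Real.logb 2 (1 + X.sinr Pt α noise ω)

/-- Rate coverage at rate threshold `τ`. -/
def rateCoverage (X : Link Ω) (P : Measure Ω) (S : Ω → ℕ∞) (B Pt α noise τ : ℝ) : ℝ :=
  P.real {ω | τ < X.rate S B Pt α noise ω}

end Link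

/-! ### Non-platooned traffic -/

/-- Randomness of the non-platooned scenario: the RSU locations that determine the cells, the
VU locations other than the typical VU, and the radio link. -/
structure NPTS (Ω : Type*) where
  rsu : ℕ → Ω → ℝ
  veh : ℕ → Ω → ℝ
  link : Link Ω

namespace NPTS

/-- Number of VUs, other than the typical one, served by the tagged RSU. -/
def taggedLoad (X : NPTS Ω) (ω : Ω) : ℕ∞ :=
  count (fun i => X.veh i ω) (taggedCell fun i => X.rsu i ω)

/-- Number of VUs served by the typical RSU. -/
def typicalLoad (X : NPTS Ω) (ω : Ω) : ℕ∞ :=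
  count (fun i => X.veh i ω) (typicalCell fun i => X.rsu i ω)

/-- Probability that the typical RSU serves at least one VU. -/
def activeProb (X : NPTS Ω) (P : Measure Ω) : ℝ := P.real {ω | 1 ≤ X.typicalLoad ω}

/-- The non-platooned scenario with RSU density `lr` and VU density `lv`. -/
structure IsModel (X : NPTS Ω) (P : Measure Ω) (lr lv : ℝ) : Prop where
  rsu_ppp : IsPPP P X.rsu lr
  veh_ppp : IsPPP P X.veh lv
  link_model : X.link.IsModel P lr (X.activeProb P * lr)
  indep : iIndep ![gen (fun ω i => X.rsu i ω), gen (fun ω i => X.veh i ω),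
    gen (fun ω i => X.link.rsu i ω), gen (fun ω i => X.link.active i ω),
    gen X.link.gain, gen (fun ω i => X.link.gains i ω)] P

end NPTS

/-! ### Platooned traffic -/

/-- Randomness of the platooned scenario. Platoon `i` has its centre at `parent i`, it has
`size i` VUs, and its `j`-th VU (`j < size i`) is at `parent i + offset i j`. The tagged platoon,
the one of the typical VU, is described by `parent₀`, `size₀`, `offset₀`; its `size₀` VUs do not
include the typical VU. -/
structure PTS (Ω : Type*) where
  rsu : ℕ → Ω → ℝ
  parent : ℕ → Ω → ℝ
  size : ℕ → Ω → ℕ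
  offset : ℕ → ℕ → Ω → ℝ
  parent₀ : Ω → ℝ
  size₀ : Ω → ℕ
  offset₀ : ℕ → Ω → ℝ
  link : Link Ω

namespace PTS

/-- Number of points in `A` of the Matérn cluster pattern (without the tagged platoon). -/
def clusterCount (X : PTS Ω) (ω : Ω) (A : Set ℝ) : ℕ∞ :=
  {q : ℕ × ℕ | q.2 < X.size q.1 ω ∧ X.parent q.1 ω + X.offset q.1 q.2 ω ∈ A}.encard

/-- Number of VUs in `A` of the tagged platoon, without the typical VU. -/
def platoonCount (X : PTS Ω) (ω : Ω) (A : Set ℝ) : ℕ∞ :=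
  {j : ℕ | j < X.size₀ ω ∧ X.parent₀ ω + X.offset₀ j ω ∈ A}.encard

/-- Number of VUs, other than the typical one, served by the tagged RSU. -/
def taggedLoad (X : PTS Ω) (ω : Ω) : ℕ∞ :=
  X.clusterCount ω (taggedCell fun i => X.rsu i ω) +
    X.platoonCount ω (taggedCell fun i => X.rsu i ω)

/-- Number of VUs served by the typical RSU. -/
def typicalLoad (X : PTS Ω) (ω : Ω) : ℕ∞ :=
  X.clusterCount ω (typicalCell fun i => X.rsu i ω)

/-- Probability that the typical RSU serves at least one VU. -/
def activeProb (X : PTS Ω) (P : Measure Ω) : ℝ := P.real {ω | 1 ≤ X.typicalLoad ω}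

/-- The platooned scenario with RSU density `lr`, platoon density `lp`, mean platoon size `m` and
platoon radius `a`. Seen from the typical VU at the origin, the other VUs form a Matérn cluster
pattern and, independently, one more cluster whose centre is uniform on `[-a, a]`. -/
structure IsModel (X : PTS Ω) (P : Measure Ω) (lr lp m a : ℝ) : Prop where
  rsu_ppp : IsPPP P X.rsu lr
  parent_ppp : IsPPP P X.parent lp
  size_meas : ∀ i, Measurable (X.size i)
  size_law : ∀ i, P.map (X.size i) = poissonMeasure m.toNNReal
  size_indep : iIndepFun X.size P
  offset_meas : ∀ i j, Measurable (X.offset i j)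
  offset_law : ∀ i j, P.map (X.offset i j) = uniformBall a
  offset_indep : iIndepFun (fun q : ℕ × ℕ => X.offset q.1 q.2) P
  parent₀_meas : Measurable X.parent₀
  parent₀_law : P.map X.parent₀ = uniformBall a
  size₀_meas : Measurable X.size₀
  size₀_law : P.map X.size₀ = poissonMeasure m.toNNReal
  offset₀_meas : ∀ j, Measurable (X.offset₀ j)
  offset₀_law : ∀ j, P.map (X.offset₀ j) = uniformBall a
  offset₀_indep : iIndepFun X.offset₀ P
  link_model : X.link.IsModel P lr (X.activeProb P * lr)
  indep : iIndep ![gen (fun ω i => X.rsu i ω), gen (fun ω i => X.parent i ω),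
    gen (fun ω i => X.size i ω), gen (fun ω (q : ℕ × ℕ) => X.offset q.1 q.2 ω),
    gen X.parent₀, gen X.size₀, gen (fun ω j => X.offset₀ j ω),
    gen (fun ω i => X.link.rsu i ω), gen (fun ω i => X.link.active i ω),
    gen X.link.gain, gen (fun ω i => X.link.gains i ω)] P

end PTS

end

end Platoon

end

/-! Given `k` further VUs in the tagged cell, the rate exceeds `τ` exactly when the SINR exceeds `2
^ (τ * (k + 1) / B) - 1` (`Link.lt_rate_iff`). An infinite load gives rate `0`, so the event is the
disjoint union over finite `k` of {load `= k`} ∩ {SINR above the `k`-th threshold}. Countable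
additivity gives the series, and independence of load and SINR factors each term
(`Link.hasSum_rateCoverage`). What remains is to show that the load and the SINR are measurable for
σ-algebras generated by disjoint groups of the independent components; both scenarios then follow.
-/

namespace Platoon

/-! ### Measurability of the load and of the SINR -/

section Measurability

variable {Ω : Type*} [MeasurableSpace Ω]

theorem measurableSet_mem_taggedCell {z : ℕ → Ω → ℝ} (hz : ∀ i, Measurable (z i)) {y : Ω → ℝ}
    (hy : Measurable y) : MeasurableSet {ω | y ω ∈ taggedCell fun i => z i ω} := by
  have h (y : Ω → ℝ) (hy : Measurable y) (k : ℕ) :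
      MeasurableSet {ω | y ω ∈ voronoiCell (fun i => z i ω) (z k ω)} := by
    have hset : {ω | y ω ∈ voronoiCell (fun i => z i ω) (z k ω)} =
        ⋂ j, {ω | |y ω - z k ω| ≤ |y ω - z j ω|} := by
      ext ω
      simp [voronoiCell]
    rw [hset]
    exact MeasurableSet.iInter fun j =>
      measurableSet_le (hy.sub (hz k)).abs (hy.sub (hz j)).abs
  have hset : {ω | y ω ∈ taggedCell fun i => z i ω} =
      ⋃ k, {ω | (0 : ℝ) ∈ voronoiCell (fun i => z i ω) (z k ω)} ∩
        {ω | y ω ∈ voronoiCell (fun i => z i ω) (z k ω)} := by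
    ext ω
    simp [taggedCell]
  rw [hset]
  exact MeasurableSet.iUnion fun k => (h (fun _ => 0) measurable_const k).inter (h y hy k)

/-- A set with `k` elements equals one of the `k`-element finsets, and a countable index type has
only countably many of those. -/
theorem measurableSet_encard_eq {ι : Type*} [Countable ι] {p : ι → Ω → Prop}
    (hp : ∀ i, MeasurableSet {ω | p i ω}) (k : ℕ) :
    MeasurableSet {ω | {i | p i ω}.encard = (k : ℕ∞)} := by
  have h : {ω | {i | p i ω}.encard = (k : ℕ∞)} =
      ⋃ F : {F : Finset ι // F.card = k}, ⋂ i, {ω | p i ω ↔ i ∈ F.1} := by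
    ext ω
    simp only [Set.mem_ofPred_eq, Set.mem_iUnion, Set.mem_iInter]
    constructor
    · intro h
      have hf : {i | p i ω}.Finite := Set.finite_of_encard_eq_coe h
      refine ⟨⟨hf.toFinset, ?_⟩, by simp⟩
      rw [hf.encard_eq_coe_toFinset_card] at h
      exact_mod_cast h
    · rintro ⟨⟨F, hF⟩, h⟩
      have : {i | p i ω} = (F : Set ι) := by
        ext i
        simpa using h i
      rw [this, Set.encard_coe_eq_coe_finsetCard, hF]
  rw [h]
  exact MeasurableSet.iUnion fun F => MeasurableSet.iInter fun i =>
    (hp i).iff (MeasurableSet.const _)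

theorem measurableSet_add_eq {f g : Ω → ℕ∞} (hf : ∀ k : ℕ, MeasurableSet {ω | f ω = k})
    (hg : ∀ k : ℕ, MeasurableSet {ω | g ω = k}) (k : ℕ) :
    MeasurableSet {ω | f ω + g ω = (k : ℕ∞)} := by
  have h : {ω | f ω + g ω = (k : ℕ∞)} =
      ⋃ q : {q : ℕ × ℕ // q.1 + q.2 = k}, {ω | f ω = (q.1.1 : ℕ∞)} ∩ {ω | g ω = (q.1.2 : ℕ∞)} := by
    ext ω
    simp only [Set.mem_ofPred_eq, Set.mem_iUnion, Set.mem_inter_iff]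
    constructor
    · intro h
      -- A finite sum in `ℕ∞` has finite summands, so level sets at finite values suffice.
      have hsum : f ω + g ω ≠ ⊤ := h ▸ ENat.natCast_ne_top k
      lift f ω to ℕ using fun h' => hsum (by simp [h']) with a
      lift g ω to ℕ using fun h' => hsum (by simp [h']) with b
      exact ⟨⟨(a, b), by exact_mod_cast h⟩, rfl, rfl⟩
    · rintro ⟨⟨q, rfl⟩, h₁, h₂⟩
      simp [h₁, h₂]
  rw [h]
  exact MeasurableSet.iUnion fun q => (hf _).inter (hg _)

/-- The hypotheses are bare measurability, not `IsModel`, so that the ambient σ-algebra can later be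
replaced by the one generated by the load components alone. -/
theorem NPTS.measurableSet_taggedLoad_eq (X : NPTS Ω) (hr : ∀ i, Measurable (X.rsu i))
    (hv : ∀ i, Measurable (X.veh i)) (k : ℕ) :
    MeasurableSet {ω | X.taggedLoad ω = (k : ℕ∞)} :=
  measurableSet_encard_eq (fun i => measurableSet_mem_taggedCell hr (hv i)) k

theorem PTS.measurableSet_taggedLoad_eq (X : PTS Ω) (hr : ∀ i, Measurable (X.rsu i))
    (hp : ∀ i, Measurable (X.parent i)) (hs : ∀ i, Measurable (X.size i))
    (ho : ∀ i j, Measurable (X.offset i j)) (hp₀ : Measurable X.parent₀)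
    (hs₀ : Measurable X.size₀) (ho₀ : ∀ j, Measurable (X.offset₀ j)) (k : ℕ) :
    MeasurableSet {ω | X.taggedLoad ω = (k : ℕ∞)} := by
  refine measurableSet_add_eq (fun k => ?_) (fun k => ?_) k
  · exact measurableSet_encard_eq (fun q : ℕ × ℕ =>
      (measurableSet_lt measurable_const (hs q.1)).inter
        (measurableSet_mem_taggedCell hr ((hp q.1).add (ho q.1 q.2)))) k
  · exact measurableSet_encard_eq (fun j : ℕ =>
      (measurableSet_lt measurable_const hs₀).inter
        (measurableSet_mem_taggedCell hr (hp₀.add (ho₀ j)))) k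

theorem Link.measurable_sinr (X : Link Ω) (hr : ∀ i, Measurable (X.rsu i))
    (ha : ∀ i, Measurable (X.active i)) (hg : Measurable X.gain)
    (hgs : ∀ i, Measurable (X.gains i)) (Pt α noise : ℝ) :
    Measurable (X.sinr Pt α noise) := by
  have hd : Measurable X.dist := Measurable.iInf fun i => (hr i).abs
  have hI : Measurable (X.interference Pt α) := by
    -- The interference is a sum in `ℝ≥0∞`, so its measurability needs no convergence.
    refine Measurable.tsum fun i => ?_
    refine Measurable.ite (measurableSet_lt hd (ha i).abs) ?_ measurable_const
    exact (((hgs i).mul_const Pt).mul ((ha i).abs.pow_const (-α))).ennreal_ofReal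
  exact (((hg.mul_const Pt).mul (hd.pow_const (-α))).ennreal_ofReal.div
    (hI.add_const _)).ennreal_toReal

end Measurability

/-! ### The series for the rate coverage under independence -/

section RateCoverage

variable {Ω : Type*}

theorem Link.lt_rate_iff (X : Link Ω) {S : Ω → ℕ∞} {B Pt α noise τ : ℝ} (hB : 0 < B)
    (hτ : 0 ≤ τ) (ω : Ω) :
    τ < X.rate S B Pt α noise ω ↔ ∃ k : ℕ, S ω = k ∧
      (2 : ℝ) ^ (τ * ((k : ℝ) + 1) / B) - 1 < X.sinr Pt α noise ω := by
  have hs : 0 ≤ X.sinr Pt α noise ω := ENNReal.toReal_nonneg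
  unfold rate
  rcases eq_or_ne (S ω) ⊤ with h | h
  -- Infinite load: the rate is `0`, which cannot exceed `τ ≥ 0`, and no finite `k` matches.
  · simp [h, hτ]
  · lift S ω to ℕ using h with n
    have hn : (0 : ℝ) < n + 1 := by positivity
    have hc : (ENNReal.ofReal B / (((n : ℕ∞) : ℝ≥0∞) + 1)).toReal = B / (n + 1) := by
      rw [ENNReal.toReal_div, ENNReal.toReal_ofReal hB.le,
        ENNReal.toReal_add (by simp) ENNReal.one_ne_top]
      simp
    have key : τ < B / (n + 1) * Real.logb 2 (1 + X.sinr Pt α noise ω) ↔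
        (2 : ℝ) ^ (τ * ((n : ℝ) + 1) / B) - 1 < X.sinr Pt α noise ω := by
      rw [sub_lt_iff_lt_add', ← Real.lt_logb_iff_rpow_lt one_lt_two (by linarith),
        div_lt_iff₀ hB, div_mul_eq_mul_div, lt_div_iff₀ hn, mul_comm B]
    rw [hc, key]
    simp only [Nat.cast_inj, exists_eq_left']

/-- The common core of both scenarios: `m₁` carries the load, `m₂` the SINR. -/
theorem Link.hasSum_rateCoverage {m₁ m₂ : MeasurableSpace Ω} [mΩ : MeasurableSpace Ω]
    (P : Measure Ω) [IsProbabilityMeasure P] (X : Link Ω) {S : Ω → ℕ∞} {B Pt α noise τ : ℝ}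
    (hB : 0 < B) (hτ : 0 ≤ τ) (h₁ : m₁ ≤ mΩ) (h₂ : m₂ ≤ mΩ) (hind : Indep m₁ m₂ P)
    (hS : ∀ k : ℕ, MeasurableSet[m₁] {ω | S ω = k})
    (hX : Measurable[m₂] (X.sinr Pt α noise)) :
    HasSum (fun k : ℕ => P.real {ω | S ω = (k : ℕ∞)} *
      X.coverage P Pt α noise ((2 : ℝ) ^ (τ * ((k : ℝ) + 1) / B) - 1))
      (X.rateCoverage P S B Pt α noise τ) := by
  set E : ℕ → Set Ω := fun k => {ω | S ω = (k : ℕ∞)}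
  set C : ℕ → Set Ω := fun k =>
    {ω | (2 : ℝ) ^ (τ * ((k : ℝ) + 1) / B) - 1 < X.sinr Pt α noise ω}
  have hC (k : ℕ) : MeasurableSet[m₂] (C k) := hX measurableSet_Ioi
  have hrate : {ω | τ < X.rate S B Pt α noise ω} = ⋃ k, E k ∩ C k := by
    ext ω
    simpa [E, C] using X.lt_rate_iff hB hτ ω
  have hdisj : Pairwise (Function.onFun Disjoint fun k => E k ∩ C k) := by
    intro i j hij
    refine Set.disjoint_left.2 fun ω hi hj => hij ?_
    have : (i : ℕ∞) = j := hi.1.symm.trans hj.1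
    exact_mod_cast this
  have hmeas (k : ℕ) : MeasurableSet (E k ∩ C k) := (h₁ _ (hS k)).inter (h₂ _ (hC k))
  have htsum := measure_iUnion (μ := P) hdisj hmeas
  -- The terms add up to the probability of one event, so the `ℝ≥0∞` series is finite and passes to
  -- `ℝ`.
  have htop : ∑' k, P (E k ∩ C k) ≠ ∞ := htsum ▸ measure_ne_top P _
  have hprod (k : ℕ) : (P (E k ∩ C k)).toReal = P.real {ω | S ω = (k : ℕ∞)} *
      X.coverage P Pt α noise ((2 : ℝ) ^ (τ * ((k : ℝ) + 1) / B) - 1) := by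
    rw [(Indep_iff m₁ m₂ P).1 hind _ _ (hS k) (hC k), ENNReal.toReal_mul]
    rfl
  unfold rateCoverage
  rw [hrate, measureReal_def, htsum,
    ENNReal.tsum_toReal_eq fun k => measure_ne_top P _]
  simp_rw [← hprod]
  exact ENNReal.hasSum_toReal htop

end RateCoverage

/-! ### The two traffic scenarios -/

theorem measurable_apply_of_gen_le {Ω ι E : Type*} [MeasurableSpace E] {X : ι → Ω → E}
    {m : MeasurableSpace Ω} (h : gen (fun ω i => X i ω) ≤ m) (i : ι) : Measurable[m] (X i) :=
  ((measurable_pi_apply i).comp (comap_measurable fun ω i => X i ω)).mono h le_rfl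

theorem PTS.hasSum_rateCoverage {Ω : Type*} [MeasurableSpace Ω] (P : Measure Ω)
    [IsProbabilityMeasure P] {X : PTS Ω} {lr lp m a : ℝ} (hX : X.IsModel P lr lp m a)
    {Pt α noise B τ : ℝ} (hB : 0 < B) (hτ : 0 ≤ τ) :
    HasSum (fun k : ℕ => P.real {ω | X.taggedLoad ω = (k : ℕ∞)} *
        X.link.coverage P Pt α noise ((2 : ℝ) ^ (τ * ((k : ℝ) + 1) / B) - 1))
      (X.link.rateCoverage P X.taggedLoad B Pt α noise τ) := by
  set g : Fin 11 → MeasurableSpace Ω := ![gen (fun ω i => X.rsu i ω),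
    gen (fun ω i => X.parent i ω), gen (fun ω i => X.size i ω),
    gen (fun ω (q : ℕ × ℕ) => X.offset q.1 q.2 ω), gen X.parent₀, gen X.size₀,
    gen (fun ω j => X.offset₀ j ω), gen (fun ω i => X.link.rsu i ω),
    gen (fun ω i => X.link.active i ω), gen X.link.gain,
    gen (fun ω i => X.link.gains i ω)] with hg
  have hl := hX.link_model
  have hle : ∀ i, g i ≤ ‹MeasurableSpace Ω› := by
    simp only [hg, Fin.forall_fin_succ]
    exact ⟨(measurable_pi_lambda _ hX.rsu_ppp.measurable).comap_le,
      (measurable_pi_lambda _ hX.parent_ppp.measurable).comap_le,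
      (measurable_pi_lambda _ hX.size_meas).comap_le,
      (measurable_pi_lambda _ fun q : ℕ × ℕ => hX.offset_meas q.1 q.2).comap_le,
      hX.parent₀_meas.comap_le, hX.size₀_meas.comap_le,
      (measurable_pi_lambda _ hX.offset₀_meas).comap_le,
      (measurable_pi_lambda _ hl.rsu_ppp.measurable).comap_le,
      (measurable_pi_lambda _ hl.active_ppp.measurable).comap_le,
      hl.gain_meas.comap_le,
      (measurable_pi_lambda _ hl.gains_meas).comap_le, fun i => i.elim0⟩
  -- Components `0`–`6` determine the load, `7`–`10` the SINR; mutual independence makes the joins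
  -- of the two groups independent.
  have hind := indep_iSup_of_disjoint hle hX.indep
    (disjoint_compl_right (a := {i : Fin 11 | i < 7}))
  have h₁ (i : Fin 11) (hi : i < 7) : g i ≤ ⨆ i ∈ {i : Fin 11 | i < 7}, g i :=
    le_iSup₂_of_le i hi le_rfl
  have h₂ (i : Fin 11) (hi : ¬ i < 7) : g i ≤ ⨆ i ∈ {i : Fin 11 | i < 7}ᶜ, g i :=
    le_iSup₂_of_le i hi le_rfl
  refine X.link.hasSum_rateCoverage P hB hτ (iSup₂_le fun i _ => hle i)
    (iSup₂_le fun i _ => hle i) hind ?_ ?_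
  -- The σ-algebra is passed explicitly: measurability is needed for the join of the load group, not
  -- for the ambient one.
  · exact @PTS.measurableSet_taggedLoad_eq Ω (⨆ i ∈ {i : Fin 11 | i < 7}, g i) X
      (measurable_apply_of_gen_le (h₁ 0 (by decide)))
      (measurable_apply_of_gen_le (h₁ 1 (by decide)))
      (measurable_apply_of_gen_le (h₁ 2 (by decide)))
      (fun i j => measurable_apply_of_gen_le (X := fun q : ℕ × ℕ => X.offset q.1 q.2)
        (h₁ 3 (by decide)) (i, j))
      ((comap_measurable _).mono (h₁ 4 (by decide)) le_rfl)
      ((comap_measurable _).mono (h₁ 5 (by decide)) le_rfl)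
      (measurable_apply_of_gen_le (h₁ 6 (by decide)))
  · exact @Link.measurable_sinr Ω (⨆ i ∈ {i : Fin 11 | i < 7}ᶜ, g i) X.link
      (measurable_apply_of_gen_le (h₂ 7 (by decide)))
      (measurable_apply_of_gen_le (h₂ 8 (by decide)))
      ((comap_measurable _).mono (h₂ 9 (by decide)) le_rfl)
      (measurable_apply_of_gen_le (h₂ 10 (by decide))) Pt α noise

theorem NPTS.hasSum_rateCoverage {Ω : Type*} [MeasurableSpace Ω] (P : Measure Ω)
    [IsProbabilityMeasure P] {X : NPTS Ω} {lr lv : ℝ} (hX : X.IsModel P lr lv)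
    {Pt α noise B τ : ℝ} (hB : 0 < B) (hτ : 0 ≤ τ) :
    HasSum (fun k : ℕ => P.real {ω | X.taggedLoad ω = (k : ℕ∞)} *
        X.link.coverage P Pt α noise ((2 : ℝ) ^ (τ * ((k : ℝ) + 1) / B) - 1))
      (X.link.rateCoverage P X.taggedLoad B Pt α noise τ) := by
  set g : Fin 6 → MeasurableSpace Ω := ![gen (fun ω i => X.rsu i ω), gen (fun ω i => X.veh i ω),
    gen (fun ω i => X.link.rsu i ω), gen (fun ω i => X.link.active i ω),
    gen X.link.gain, gen (fun ω i => X.link.gains i ω)] with hg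
  have hl := hX.link_model
  have hle : ∀ i, g i ≤ ‹MeasurableSpace Ω› := by
    simp only [hg, Fin.forall_fin_succ]
    exact ⟨(measurable_pi_lambda _ hX.rsu_ppp.measurable).comap_le,
      (measurable_pi_lambda _ hX.veh_ppp.measurable).comap_le,
      (measurable_pi_lambda _ hl.rsu_ppp.measurable).comap_le,
      (measurable_pi_lambda _ hl.active_ppp.measurable).comap_le,
      hl.gain_meas.comap_le,
      (measurable_pi_lambda _ hl.gains_meas).comap_le, fun i => i.elim0⟩
  -- Here the load group is just the RSUs and the VUs, components `0` and `1`.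
  have hind := indep_iSup_of_disjoint hle hX.indep
    (disjoint_compl_right (a := {i : Fin 6 | i < 2}))
  have h₁ (i : Fin 6) (hi : i < 2) : g i ≤ ⨆ i ∈ {i : Fin 6 | i < 2}, g i :=
    le_iSup₂_of_le i hi le_rfl
  have h₂ (i : Fin 6) (hi : ¬ i < 2) : g i ≤ ⨆ i ∈ {i : Fin 6 | i < 2}ᶜ, g i :=
    le_iSup₂_of_le i hi le_rfl
  refine X.link.hasSum_rateCoverage P hB hτ (iSup₂_le fun i _ => hle i)
    (iSup₂_le fun i _ => hle i) hind ?_ ?_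
  · exact @NPTS.measurableSet_taggedLoad_eq Ω (⨆ i ∈ {i : Fin 6 | i < 2}, g i) X
      (measurable_apply_of_gen_le (h₁ 0 (by decide)))
      (measurable_apply_of_gen_le (h₁ 1 (by decide)))
  · exact @Link.measurable_sinr Ω (⨆ i ∈ {i : Fin 6 | i < 2}ᶜ, g i) X.link
      (measurable_apply_of_gen_le (h₂ 2 (by decide)))
      (measurable_apply_of_gen_le (h₂ 3 (by decide)))
      ((comap_measurable _).mono (h₂ 4 (by decide)) le_rfl)
      (measurable_apply_of_gen_le (h₂ 5 (by decide))) Pt α noise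

end Platoon

theorem theorem11 {Ω : Type*} [MeasurableSpace Ω] (P : Measure Ω) [IsProbabilityMeasure P]
    (lr Pt α noise B τ : ℝ) (hlr : 0 < lr) (hPt : 0 < Pt) (hα : 0 < α) (hnoise : 0 < noise)
    (hB : 0 < B) (hτ : 0 ≤ τ) :
    (∀ (lp m a : ℝ), 0 < lp → 0 < m → 0 < a → ∀ X : Platoon.PTS Ω, X.IsModel P lr lp m a →
      HasSum (fun k : ℕ => P.real {ω | X.taggedLoad ω = (k : ℕ∞)} *
          X.link.coverage P Pt α noise ((2 : ℝ) ^ (τ * ((k : ℝ) + 1) / B) - 1))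
        (X.link.rateCoverage P X.taggedLoad B Pt α noise τ)) ∧
    (∀ lv : ℝ, 0 < lv → ∀ X : Platoon.NPTS Ω, X.IsModel P lr lv →
      HasSum (fun k : ℕ => P.real {ω | X.taggedLoad ω = (k : ℕ∞)} *
          X.link.coverage P Pt α noise ((2 : ℝ) ^ (τ * ((k : ℝ) + 1) / B) - 1))
        (X.link.rateCoverage P X.taggedLoad B Pt α noise τ)) := by
  exact ⟨fun _ _ _ _ _ _ _ hX => Platoon.PTS.hasSum_rateCoverage P hX hB hτ,
    fun _ _ _ hX => Platoon.NPTS.hasSum_rateCoverage P hX hB hτ⟩
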